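/- Theorem (Mermin–Wagner theorem). Let $d\ge 0$ and $n\ge 2$ be integers, let $\beta\ge 0$, and let $(J_{x,y})_{x,y\in\mathbb Z^d}$ be non-negative real numbers with (I1) $J_{x,x}=0$ and $J_{x,y}=J_{0,y-x}$ for all $x,y\in\mathbb Z^d$; (I2) $\sum_x |J_{0,x}|<\infty$ and $\sum_x J_{0,x}=1$. Suppose that the random walk on $\mathbb Z^d$ with transition probabilities $\mathsf P(X_{m+1}=y\mid X_m=x)=J_{x,y}$ is recurrent, i.e. started at the origin it returns to the origin infinitely often almost surely. Consider the $O(n)$-model with couplings $(J_{x,y})$: the spins $S_x$, $x\in\mathbb Z^d$, take values in the unit sphere $\mathbb S^{n-1}\subset\mathbb R^n$, the a priori measure $\mu_0$ is the surface measure on $\mathbb S^{n-1}$, and for every finite $\Lambda\subset\mathbb Z^d$ the Hamiltonian is $$H_\Lambda(S)=-\frac12\sum_{\substack{(x,y)\in\mathbb Z^d\times\mathbb Z^d\\ x\in\Lambda\text{ or }y\in\Lambda}}J_{x,y}\,S_x\cdot S_y .$$ For a boundary condition $S_{\Lambda^{\mathrm c}}$ let $\mu_{\Lambda,\beta}^{(S_{\Lambda^{\mathrm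 c}})}(\mathrm dS_\Lambda)=Z_{\Lambda,\beta}(S_{\Lambda^{\mathrm c}})^{-1}\,\mathrm e^{-\beta H_\Lambda(S)}\prod_{x\in\Lambda}\mu_0(\mathrm dS_x)$ be the finite-volume Gibbs measure on $(\mathbb S^{n-1})^\Lambda$, with $Z_{\Lambda,\beta}(S_{\Lambda^{\mathrm c}})$ the normalizing constant, and let $\mathfrak G_\beta$ be the set of infinite-volume Gibbs measures, i.e. of the probability measures $\mu$ on $(\mathbb S^{n-1})^{\mathbb Z^d}$ (with the product $\sigma$-algebra) such that for every finite $\Lambda\subset\mathbb Z^d$ the conditional law of $S_\Lambda$ under $\mu$ given $S_{\Lambda^{\mathrm c}}$ is $\mu_{\Lambda,\beta}^{(S_{\Lambda^{\mathrm c}})}$, for $\mu$-almost every $S_{\Lambda^{\mathrm c}}$. Then every $\mu\in\mathfrak G_\beta$ is invariant under every simultaneous rotation of all spins: for every rotation $A\in SO(n)$, the image of $\mu$ under the map $(S_x)_{x\in\mathbb Z^d}\mapsto(AS_x)_{x\in\mathbb Z^d}$ is $\mu$. -/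

import Mathlib

open MeasureTheory ProbabilityTheory Filter

noncomputable section

/-- The hypercubic lattice `ℤ^d`. -/
abbrev Site (d : ℕ) : Type := Fin d → ℤ

/-- The spin space of the `O(n)` model: the unit sphere of `n`-dimensional Euclidean space. -/
abbrev Spin (n : ℕ) : Type := Metric.sphere (0 : EuclideanSpace ℝ (Fin n)) 1

/-- Spin configurations on `ℤ^d`; they carry the product topology and the product σ-algebra. -/
abbrev SpinConfig (d n : ℕ) : Type := Site d → Spin n

/-- The a priori measure of a single spin: the surface measure of the unit sphere. -/
def surfaceMeasure (n : ℕ) : Measure (Spin n) :=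
  (volume : Measure (EuclideanSpace ℝ (Fin n))).toSphere

/-- The Hamiltonian in the finite volume `Λ`: all the terms of the formal sum
`-(1/2) ∑_{x,y} J_{x,y} S_x · S_y` (over ordered pairs) in which `x` or `y` lies in `Λ`. -/
def hamiltonian {d n : ℕ} (J : Site d → Site d → ℝ) (Λ : Finset (Site d))
    (S : SpinConfig d n) : ℝ :=
  -(1 / 2) * ∑' p : Site d × Site d,
    if p.1 ∈ Λ ∨ p.2 ∈ Λ then
      J p.1 p.2 * inner ℝ (S p.1 : EuclideanSpace ℝ (Fin n)) (S p.2 : EuclideanSpace ℝ (Fin n))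
    else 0

/-- The concatenation of a spin configuration `ζ` in `Λ` with the boundary condition given by the
restriction of `S` to the complement of `Λ`. -/
def concat {d n : ℕ} (Λ : Finset (Site d)) (ζ : Λ → Spin n) (S : SpinConfig d n) :
    SpinConfig d n :=
  fun x => if h : x ∈ Λ then ζ ⟨x, h⟩ else S x

/-- The Boltzmann weight `exp (-β H_Λ)` of the configuration `ζ` in `Λ`, with boundary
condition `S` outside `Λ`. -/
def boltzmannWeight {d n : ℕ} (J : Site d → Site d → ℝ) (β : ℝ) (Λ : Finset (Site d))
    (S : SpinConfig d n) (ζ : Λ → Spin n) : ENNReal :=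
  ENNReal.ofReal (Real.exp (-β * hamiltonian J Λ (concat Λ ζ S)))

/-- The partition function in `Λ` with boundary condition `S` outside `Λ`. -/
def partitionFunction {d n : ℕ} (J : Site d → Site d → ℝ) (β : ℝ) (Λ : Finset (Site d))
    (S : SpinConfig d n) : ENNReal :=
  ∫⁻ ζ, boltzmannWeight J β Λ S ζ ∂(Measure.pi fun _ : Λ => surfaceMeasure n)

/-- The finite-volume Gibbs measure in `Λ`, a measure on spin configurations in `Λ`, with
boundary condition `S` outside `Λ` (the values of `S` inside `Λ` are irrelevant). -/
def finiteGibbs {d n : ℕ} (J : Site d → Site d → ℝ) (β : ℝ) (Λ : Finset (Site d))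
    (S : SpinConfig d n) : Measure (Λ → Spin n) :=
  (partitionFunction J β Λ S)⁻¹ •
    (Measure.pi fun _ : Λ => surfaceMeasure n).withDensity (boltzmannWeight J β Λ S)

/-- Infinite-volume Gibbs measures at inverse temperature `β`: the probability measures on spin
configurations such that, for every finite `Λ`, the conditional law of the spins in `Λ` given all
the spins outside `Λ` is the finite-volume Gibbs measure with that boundary condition. -/
structure IsGibbsMeasure {d n : ℕ} (J : Site d → Site d → ℝ) (β : ℝ)
    (μ : Measure (SpinConfig d n)) : Prop where
  isProbabilityMeasure : IsProbabilityMeasure μ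
  dlr : ∀ (Λ : Finset (Site d)) (B : Set (Λ → Spin n)), MeasurableSet B →
    μ⟦Λ.restrict ⁻¹' B | cylinderEvents (X := fun _ : Site d => Spin n) (Λ : Set (Site d))ᶜ⟧
      =ᵐ[μ] fun S => (finiteGibbs J β Λ S).real B

/-- The measure on `ℤ^d` which gives mass `p y` to each `y`. -/
def stepLaw {d : ℕ} (p : Site d → ℝ) : Measure (Site d) :=
  Measure.sum fun y => ENNReal.ofReal (p y) • Measure.dirac y

/-- A non-negative family of total mass one defines a probability measure. -/
theorem isProbabilityMeasure_stepLaw {d : ℕ} {p : Site d → ℝ} (h0 : ∀ y, 0 ≤ p y)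
    (h1 : HasSum p 1) : IsProbabilityMeasure (stepLaw p) := by
  constructor
  simp only [stepLaw, Measure.sum_apply _ MeasurableSet.univ, Measure.smul_apply, measure_univ,
    smul_eq_mul, mul_one]
  rw [← ENNReal.ofReal_tsum_of_nonneg h0 h1.summable, h1.tsum_eq, ENNReal.ofReal_one]

/-- The position at time `m` of the walk started at the origin whose successive steps are
`ω 0, ω 1, …`. -/
def walk {d : ℕ} (ω : ℕ → Site d) (m : ℕ) : Site d := ∑ i ∈ Finset.range m, ω i

/-- Recurrence of the random walk with i.i.d. steps of law `p`, i.e. of the Markov chain on `ℤ^d`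
with transition probabilities `(x, y) ↦ p (y - x)`: started at the origin, it returns to the
origin infinitely often almost surely. -/
def IsRecurrentWalk {d : ℕ} (p : Site d → ℝ) : Prop :=
  Measure.infinitePi (fun _ : ℕ => stepLaw p) {ω | ∃ᶠ m in atTop, walk ω m = 0} = 1

/-- The simultaneous action of a linear isometry of `ℝ^n` on all spins. -/
def rotateSpins {d n : ℕ}
    (A : EuclideanSpace ℝ (Fin n) ≃ₗᵢ[ℝ] EuclideanSpace ℝ (Fin n))
    (S : SpinConfig d n) : SpinConfig d n :=
  fun x => ⟨A (S x), by simp⟩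

end

/-!
The proof uses two facts: recurrence makes slowly varying rotations cost arbitrarily little
energy, and averaging a rotation with its inverse removes the first-order term of the cost.

*Cutoff functions.* Let `ψ` be the Green function of the walk up to time `N`. Since
`(1 - P*) ψ ≤ δ_0`, summation by parts bounds the Dirichlet energy
`∑ J_{x,y} (ψ_x - ψ_y)²` by `2 ψ(0)`, whether or not the walk is symmetric, so `ψ / ψ(0)` has
energy at most `2 / ψ(0)`. By the Borel-Cantelli lemma, `ψ(0) → ∞` as `N → ∞` for a recurrent
walk. Truncating `ψ / ψ(0)` and taking the maximum of finitely many translates gives finitely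
supported functions of arbitrarily small energy which equal `1` on a prescribed finite set
(`exists_cutoff`); irreducibility of the walk is not needed.

*A convexity inequality.* Let `R` be a one-parameter group of planar rotations, and rotate the
spin at `x` by the angle `φ_x`, where `φ` has finite support. The sum of the energies of the
configurations rotated by `φ` and by `-φ` exceeds twice the original energy by at most the
Dirichlet energy of `φ`
(`hamiltonian_rotate_add_le`). As the surface measure is invariant under rotations, a change of
variables in the finite-volume Gibbs measure and the inequality between arithmetic and geometric
means give `μ(T_φ⁻¹ D) + μ(T_{-φ}⁻¹ D) ≥ 2 exp(-β ε / 2) μ(D)` when the energy of `φ` is at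
most `ε`. With `φ = θ` on the base of a local event `D` and `ε → 0`, this becomes
`2 μ(D) ≤ μ(R_θ⁻¹ D) + μ(R_{-θ}⁻¹ D)` (`IsGibbsMeasure.two_mul_le_add`).

*Conclusion.* Applied to all the events `R_{kθ}⁻¹ D`, the inequality says that
`k ↦ μ(R_{kθ}⁻¹ D)` is a convex function on `ℤ`. It is bounded, hence constant, and `μ` is
invariant under `R_θ` (`IsGibbsMeasure.map_rotateSpins_eq`). Finally, every isometry of
determinant `1` is a product of an even number of reflections, and a product of two reflections
is a planar rotation or the identity (`rotation_induction`).
-/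

open MeasureTheory ProbabilityTheory Filter

/-! ### Expected number of returns of a recurrent walk -/

section Walk
open scoped ENNReal

variable {d : ℕ} {p : Site d → ℝ}

/-- The law of the walk at time `m`, as a family of weights: the `m`-th convolution power of
the step weights. -/
noncomputable def stepPower (p : Site d → ℝ) : ℕ → Site d → ℝ≥0∞
  | 0 => fun x => if x = 0 then 1 else 0
  | m + 1 => fun x => ∑' y, stepPower p m y * ENNReal.ofReal (p (x - y))

theorem stepLaw_singleton (x : Site d) : stepLaw p {x} = ENNReal.ofReal (p x) := by
  classical
  rw [stepLaw, Measure.sum_apply _ (measurableSet_singleton x), tsum_eq_single x]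
  · simp
  · intro y hy
    simp [hy]

theorem measurable_walk (m : ℕ) : Measurable fun ω : ℕ → Site d => walk ω m := by
  unfold walk
  fun_prop

theorem indepFun_walk_step [IsProbabilityMeasure (stepLaw p)] (m : ℕ) :
    IndepFun (fun ω : ℕ → Site d => walk ω m) (fun ω => ω m)
      (Measure.infinitePi fun _ : ℕ => stepLaw p) := by
  have h : iIndepFun (fun (i : ℕ) (ω : ℕ → Site d) => ω i)
      (Measure.infinitePi fun _ : ℕ => stepLaw p) :=
    iIndepFun_infinitePi (X := fun _ ω => ω) fun _ => measurable_id
  have h2 := h.indepFun_finsetSum_of_notMem (fun i => measurable_pi_apply i)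
    (s := Finset.range m) (i := m) (by simp)
  convert h2 using 1
  ext ω
  simp [walk]

theorem infinitePi_walk_eq [IsProbabilityMeasure (stepLaw p)] (m : ℕ) (x : Site d) :
    Measure.infinitePi (fun _ : ℕ => stepLaw p) {ω | walk ω m = x} = stepPower p m x := by
  induction m generalizing x with
  | zero =>
    by_cases hx : x = 0
    · simp [walk, stepPower, hx]
    · simp [walk, stepPower, hx, Ne.symm hx]
  | succ m ih =>
    have hset : {ω : ℕ → Site d | walk ω (m + 1) = x}
        = ⋃ y : Site d, {ω | walk ω m = y} ∩ {ω | ω m = x - y} := by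
      ext ω
      simp [walk, Finset.sum_range_succ, eq_sub_iff_add_eq, add_comm]
    have hm1 (y : Site d) : MeasurableSet {ω : ℕ → Site d | walk ω m = y} :=
      measurable_walk m (measurableSet_singleton y)
    have hm2 (y : Site d) : MeasurableSet {ω : ℕ → Site d | ω m = y} :=
      (measurable_pi_apply m : Measurable fun ω : ℕ → Site d => ω m) (measurableSet_singleton y)
    rw [hset, measure_iUnion _ fun y => (hm1 y).inter (hm2 _)]
    · simp only [stepPower]
      congr 1 with y
      have h1 := (indepFun_walk_step (p := p) m).measure_inter_preimage_eq_mul _ _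
        (measurableSet_singleton y) (measurableSet_singleton (x - y))
      have h2 : Measure.infinitePi (fun _ : ℕ => stepLaw p) {ω | ω m = x - y}
          = ENNReal.ofReal (p (x - y)) := by
        rw [← stepLaw_singleton,
          ← (measurePreserving_eval_infinitePi (fun _ : ℕ => stepLaw p) m).measure_preimage
            (measurableSet_singleton (x - y)).nullMeasurableSet]
        rfl
      rw [← ih y, ← h2]
      exact h1
    · intro y z hyz
      refine Set.disjoint_left.2 fun ω hy hz => hyz ?_
      exact hy.1.symm.trans hz.1

/-- By the Borel-Cantelli lemma, a recurrent walk has an infinite expected number of returns. -/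
theorem tsum_stepPower_eq_top [IsProbabilityMeasure (stepLaw p)] (hp : IsRecurrentWalk p) :
    ∑' m, stepPower p m 0 = ∞ := by
  by_contra h
  have h0 := measure_setOfPred_frequently_eq_zero
    (μ := Measure.infinitePi fun _ : ℕ => stepLaw p) (p := fun m ω => walk ω m = 0)
    (by simpa only [infinitePi_walk_eq] using h)
  rw [IsRecurrentWalk, h0] at hp
  exact zero_ne_one hp

/-- The Green function of the walk up to time `N`: the expected number of visits to `x`
before time `N`. -/
noncomputable def greenUpTo (p : Site d → ℝ) (N : ℕ) (x : Site d) : ℝ≥0∞ :=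
  ∑ m ∈ Finset.range N, stepPower p m x

theorem tsum_stepPower (hp : ∑' x, ENNReal.ofReal (p x) = 1) (m : ℕ) :
    ∑' x, stepPower p m x = 1 := by
  induction m with
  | zero => simp [stepPower]
  | succ m ih =>
    simp only [stepPower]
    rw [ENNReal.tsum_comm, ← ih]
    congr 1 with y
    have h : ∑' x, ENNReal.ofReal (p (x - y)) = ∑' x, ENNReal.ofReal (p x) :=
      (Equiv.subRight y).tsum_eq fun x => ENNReal.ofReal (p x)
    rw [ENNReal.tsum_mul_left, h, hp, mul_one]

theorem tsum_greenUpTo (hp : ∑' x, ENNReal.ofReal (p x) = 1) (N : ℕ) :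
    ∑' x, greenUpTo p N x = N := by
  simp only [greenUpTo]
  rw [Summable.tsum_finsetSum fun _ _ => ENNReal.summable]
  simp [tsum_stepPower hp]

/-- The Green function up to time `N` solves the Poisson equation up to a non-negative error. -/
theorem greenUpTo_le (N : ℕ) (x : Site d) :
    greenUpTo p N x ≤
      (if x = 0 then 1 else 0) + ∑' y, greenUpTo p N y * ENNReal.ofReal (p (x - y)) := by
  have h : (if x = 0 then 1 else 0) + ∑' y, greenUpTo p N y * ENNReal.ofReal (p (x - y))
      = greenUpTo p (N + 1) x := by
    simp only [greenUpTo, Finset.sum_range_succ', Finset.sum_mul]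
    rw [Summable.tsum_finsetSum fun _ _ => ENNReal.summable, add_comm]
    rfl
  rw [h, greenUpTo, greenUpTo, Finset.sum_range_succ]
  exact le_self_add

theorem greenUpTo_ne_top (hp : ∑' x, ENNReal.ofReal (p x) = 1) (N : ℕ) (x : Site d) :
    greenUpTo p N x ≠ ∞ :=
  ne_top_of_le_ne_top (by rw [tsum_greenUpTo hp]; simp) (ENNReal.le_tsum x)

end Walk

/-! ### Dirichlet energy and cutoff functions -/

section Energy
open scoped ENNReal

variable {d : ℕ}

/-- The Dirichlet energy `∑ J_{x,y} (φ_x - φ_y)²` over ordered pairs, with values in `[0, ∞]`. -/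
noncomputable def dirichletEnergy (J : Site d → Site d → ℝ) (φ : Site d → ℝ) : ℝ≥0∞ :=
  ∑' q : Site d × Site d, ENNReal.ofReal (J q.1 q.2) * ENNReal.ofReal ((φ q.1 - φ q.2) ^ 2)

/-- The energy of the Green function `ψ` up to time `N` is at most `2 ψ(0)`: summation by parts
turns the energy into `2 ⟨ψ, (1 - P) ψ⟩`, and `(1 - P*) ψ ≤ δ_0`. Symmetry of the walk is not
used. -/
theorem dirichletEnergy_greenUpTo_le {J : Site d → Site d → ℝ}
    (hJ_trans : ∀ x y, J x y = J 0 (y - x)) (hp : ∑' x, ENNReal.ofReal (J 0 x) = 1) (N : ℕ) :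
    dirichletEnergy J (fun x => (greenUpTo (J 0) N x).toReal) ≤ 2 * greenUpTo (J 0) N 0 := by
  set ψ := greenUpTo (J 0) N with hψ
  have hfin : ∀ x, ψ x ≠ ∞ := greenUpTo_ne_top hp N
  set A : ℝ≥0∞ := ∑' x, ψ x * ψ x
  set B : ℝ≥0∞ := ∑' x, ∑' y, ENNReal.ofReal (J x y) * (ψ x * ψ y)
  have hA : A ≠ ∞ := by
    have hsum := tsum_greenUpTo hp N
    have : A ≤ ∑' x, (N : ℝ≥0∞) * ψ x := by
      refine ENNReal.tsum_le_tsum fun x => mul_le_mul_left ?_ _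
      rw [← hsum]
      exact ENNReal.le_tsum x
    refine ne_top_of_le_ne_top ?_ this
    rw [ENNReal.tsum_mul_left, hsum]
    exact ENNReal.mul_ne_top (by simp) (by simp)
  have hrow (x : Site d) : ∑' y, ENNReal.ofReal (J x y) = 1 := by
    rw [← hp, ← (Equiv.subRight x).tsum_eq fun y => ENNReal.ofReal (J 0 y)]
    simp [hJ_trans x]
  have hcol (y : Site d) : ∑' x, ENNReal.ofReal (J x y) = 1 := by
    rw [← hp, ← (Equiv.subLeft y).tsum_eq fun y => ENNReal.ofReal (J 0 y)]
    congr 1 with x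
    rw [hJ_trans x]
    rfl
  have hBA : A ≤ ψ 0 + B := by
    calc A ≤ ∑' x, ((if x = 0 then ψ 0 else 0) + ∑' y, ENNReal.ofReal (J y x) * (ψ y * ψ x)) := by
          refine ENNReal.tsum_le_tsum fun x => ?_
          calc ψ x * ψ x ≤ ((if x = 0 then 1 else 0)
                + ∑' y, ψ y * ENNReal.ofReal (J 0 (x - y))) * ψ x :=
                mul_le_mul_left (greenUpTo_le N x) _
            _ = _ := by
                rw [add_mul, ← ENNReal.tsum_mul_right]
                congr 1
                · by_cases hx : x = 0 <;> simp [hx]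
                · congr 1 with y
                  rw [hJ_trans y x]
                  ring
      _ = ψ 0 + B := by
          rw [ENNReal.tsum_add, ENNReal.tsum_comm]
          simp [B]
  have hE : dirichletEnergy J (fun x => (ψ x).toReal) + 2 * B = 2 * A := by
    have h1 : ∑' x, ∑' y, ENNReal.ofReal (J x y) * (ψ x * ψ x) = A := by
      simp_rw [ENNReal.tsum_mul_right, hrow, one_mul]
      rfl
    have h2 : ∑' x, ∑' y, ENNReal.ofReal (J x y) * (ψ y * ψ y) = A := by
      rw [ENNReal.tsum_comm]
      simp_rw [ENNReal.tsum_mul_right, hcol, one_mul]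
      rfl
    rw [dirichletEnergy, ENNReal.tsum_prod', two_mul A]
    nth_rewrite 1 [← h1]
    rw [← h2]
    simp only [B, ← ENNReal.tsum_mul_left, ← ENNReal.tsum_add]
    congr 1 with x
    congr 1 with y
    obtain ⟨a, ha⟩ : ∃ a, a = (ψ x).toReal := ⟨_, rfl⟩
    obtain ⟨b, hb⟩ : ∃ b, b = (ψ y).toReal := ⟨_, rfl⟩
    have ha0 : 0 ≤ a := ha ▸ ENNReal.toReal_nonneg
    have hb0 : 0 ≤ b := hb ▸ ENNReal.toReal_nonneg
    rw [← ha, ← hb, ← ENNReal.ofReal_toReal (hfin x), ← ENNReal.ofReal_toReal (hfin y), ← ha, ← hb]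
    have key : ENNReal.ofReal ((a - b) ^ 2)
        + 2 * (ENNReal.ofReal a * ENNReal.ofReal b)
        = ENNReal.ofReal a * ENNReal.ofReal a + ENNReal.ofReal b * ENNReal.ofReal b := by
      rw [← ENNReal.ofReal_mul ha0, ← ENNReal.ofReal_mul ha0, ← ENNReal.ofReal_mul hb0,
        show (2 : ℝ≥0∞) = ENNReal.ofReal 2 by simp, ← ENNReal.ofReal_mul (by norm_num),
        ← ENNReal.ofReal_add (by positivity) (by positivity),
        ← ENNReal.ofReal_add (by positivity) (by positivity)]
      congr 1
      ring
    rw [← mul_add, ← key]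
    ring
  have h2B : 2 * B ≠ ∞ := ne_top_of_le_ne_top (ENNReal.mul_ne_top (by simp) hA)
    (hE ▸ le_add_self)
  refine (ENNReal.add_le_add_iff_right h2B).1 ?_
  rw [hE, ← mul_add]
  gcongr

theorem dirichletEnergy_comp_sub {J : Site d → Site d → ℝ}
    (hJ_trans : ∀ x y, J x y = J 0 (y - x)) (φ : Site d → ℝ) (z : Site d) :
    dirichletEnergy J (fun x => φ (x - z)) = dirichletEnergy J φ := by
  rw [dirichletEnergy, dirichletEnergy, ← ((Equiv.subRight z).prodCongr (Equiv.subRight z)).tsum_eq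
    fun q => ENNReal.ofReal (J q.1 q.2) * ENNReal.ofReal ((φ q.1 - φ q.2) ^ 2)]
  congr 1 with q
  simp [hJ_trans q.1 q.2, hJ_trans (q.1 - z)]

/-- Recurrence forces the capacity of finite sets to vanish: there are finitely supported
functions of arbitrarily small energy which are equal to `1` on a given finite set. -/
theorem exists_cutoff {J : Site d → Site d → ℝ}
    (hJ_trans : ∀ x y, J x y = J 0 (y - x)) (hJ_nonneg : ∀ x y, 0 ≤ J x y)
    (hJ_sum : HasSum (J 0) 1) (hJ_rec : IsRecurrentWalk (J 0)) (Λ : Finset (Site d))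
    {ε : ℝ≥0∞} (hε : ε ≠ 0) :
    ∃ φ : Site d → ℝ, φ.support.Finite ∧ (∀ x ∈ Λ, φ x = 1) ∧ dirichletEnergy J φ ≤ ε := by
  have hp : ∑' x, ENNReal.ofReal (J 0 x) = 1 := by
    rw [← ENNReal.ofReal_tsum_of_nonneg (hJ_nonneg 0) hJ_sum.summable, hJ_sum.tsum_eq,
      ENNReal.ofReal_one]
  have := isProbabilityMeasure_stepLaw (hJ_nonneg 0) hJ_sum
  -- The truncation below has Lipschitz constant `2`, so it turns the energy `2 / ψ(0)` of
  -- `ψ / ψ(0)` into at most `8 / ψ(0)`, and `|Λ|` translates of it are combined.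
  have htend : Tendsto (fun N => greenUpTo (J 0) N 0) atTop (nhds ∞) := by
    rw [← tsum_stepPower_eq_top hJ_rec]
    exact ENNReal.tendsto_nat_tsum _
  obtain ⟨N, hN⟩ := (htend.eventually (eventually_gt_nhds
    (show 8 * (Λ.card : ℝ≥0∞) / ε < ∞ from ENNReal.div_lt_top
      (ENNReal.mul_ne_top (by simp) (by simp)) hε))).exists
  set g := greenUpTo (J 0) N with hg
  have hg0 : g 0 ≠ 0 := (pos_of_gt hN).ne'
  have hgt : ∀ x, g x ≠ ∞ := greenUpTo_ne_top hp N
  set c : ℝ := (g 0).toReal with hc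
  have hc0 : 0 < c := ENNReal.toReal_pos hg0 (hgt 0)
  -- The truncation `clamp (2 ψ / ψ(0) - 1)` has finite support and the value `1` at the origin.
  set η : Site d → ℝ := fun x => max 0 (min 1 (2 * (g x).toReal / c - 1)) with hη
  have hη1 (x) : η x ≤ 1 := max_le zero_le_one (min_le_left _ _)
  have hη0 : η 0 = 1 := by
    simp only [hη, ← hc]
    rw [mul_div_assoc, div_self hc0.ne']
    norm_num
  have hηfin : η.support.Finite := by
    have hs : Summable fun x => (g x).toReal :=
      ENNReal.summable_toReal (by rw [tsum_greenUpTo hp]; simp)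
    have h1 : ∀ᶠ x in cofinite, (g x).toReal < c / 2 :=
      hs.tendsto_cofinite_zero.eventually (eventually_lt_nhds (by positivity))
    refine h1.subset fun x hx hlt => hx ?_
    have : 2 * (g x).toReal / c - 1 ≤ 0 := by
      rw [sub_nonpos, div_le_one hc0]
      have hlt : (g x).toReal < c / 2 := hlt
      linarith
    exact max_eq_left ((min_le_right _ _).trans this)
  have hηlip (x y : Site d) :
      (η x - η y) ^ 2 ≤ 4 / c ^ 2 * ((g x).toReal - (g y).toReal) ^ 2 := by
    have h : |η x - η y| ≤ |2 / c * ((g x).toReal - (g y).toReal)| := by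
      refine (abs_max_sub_max_le_max _ _ _ _).trans ?_
      rw [sub_self, abs_zero, max_eq_right (abs_nonneg _)]
      refine (abs_min_sub_min_le_max _ _ _ _).trans ?_
      rw [sub_self, abs_zero, max_eq_right (abs_nonneg _)]
      apply le_of_eq
      congr 1
      ring
    calc (η x - η y) ^ 2 ≤ (2 / c * ((g x).toReal - (g y).toReal)) ^ 2 := sq_le_sq.2 h
      _ = _ := by ring
  have hηE : dirichletEnergy J η ≤ 8 / g 0 := by
    calc dirichletEnergy J η
        ≤ ENNReal.ofReal (4 / c ^ 2) * dirichletEnergy J (fun x => (g x).toReal) := by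
          rw [dirichletEnergy, dirichletEnergy, ← ENNReal.tsum_mul_left]
          refine ENNReal.tsum_le_tsum fun q => ?_
          rw [mul_left_comm, ← ENNReal.ofReal_mul (div_nonneg (by norm_num) (sq_nonneg c))]
          exact mul_le_mul_right (ENNReal.ofReal_le_ofReal (hηlip _ _)) _
      _ ≤ ENNReal.ofReal (4 / c ^ 2) * (2 * g 0) := by
          gcongr
          exact dirichletEnergy_greenUpTo_le hJ_trans hp N
      _ = 8 / g 0 := by
          rw [← ENNReal.ofReal_toReal (hgt 0), ← hc, show (2 : ℝ≥0∞) = ENNReal.ofReal 2 by simp,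
            show (8 : ℝ≥0∞) = ENNReal.ofReal 8 by simp, ← ENNReal.ofReal_mul (by norm_num),
            ← ENNReal.ofReal_mul (by positivity), ← ENNReal.ofReal_div_of_pos hc0]
          congr 1
          field_simp
          norm_num
  -- Take the maximum of the translates by the points of `s`: the squared increment of a maximum
  -- is at most the sum of the squared increments.
  have hind (s : Finset (Site d)) : ∃ φ : Site d → ℝ, (∀ x, 0 ≤ φ x) ∧ (∀ x, φ x ≤ 1) ∧
      φ.support.Finite ∧ (∀ x ∈ s, φ x = 1) ∧ dirichletEnergy J φ ≤ s.card * (8 / g 0) := by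
    classical
    induction s using Finset.induction_on with
    | empty => exact ⟨0, by simp, by simp, by simp, by simp, by simp [dirichletEnergy]⟩
    | insert z s hz ih =>
      obtain ⟨φ, h0, h1, hf, hs, hE⟩ := ih
      refine ⟨fun x => max (φ x) (η (x - z)), fun x => le_max_of_le_left (h0 x),
        fun x => max_le (h1 x) (hη1 _), ?_, ?_, ?_⟩
      · refine (hf.union (hηfin.preimage (f := fun x => x - z)
          (sub_left_injective.injOn))).subset fun x hx => ?_
        by_contra hcon
        simp only [Set.mem_union, Set.mem_preimage, Function.mem_support, not_or, not_not] at hcon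
        exact hx (by simp [hcon.1, hcon.2])
      · intro x hx
        rcases Finset.mem_insert.1 hx with rfl | hx
        · simp [hη0, h1]
        · simp [hs x hx, hη1]
      · calc dirichletEnergy J (fun x => max (φ x) (η (x - z)))
            ≤ dirichletEnergy J φ + dirichletEnergy J (fun x => η (x - z)) := by
              rw [dirichletEnergy, dirichletEnergy, dirichletEnergy, ← ENNReal.tsum_add]
              refine ENNReal.tsum_le_tsum fun q => ?_
              rw [← mul_add, ← ENNReal.ofReal_add (sq_nonneg _) (sq_nonneg _)]
              gcongr
              have := abs_max_sub_max_le_max (φ q.1) (η (q.1 - z)) (φ q.2) (η (q.2 - z))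
              rcases le_max_iff.1 this with h | h
              · nlinarith [sq_le_sq.2 h, sq_nonneg (η (q.1 - z) - η (q.2 - z))]
              · nlinarith [sq_le_sq.2 h, sq_nonneg (φ q.1 - φ q.2)]
          _ ≤ s.card * (8 / g 0) + 8 / g 0 := by
              rw [dirichletEnergy_comp_sub hJ_trans]
              gcongr
          _ = _ := by
              rw [Finset.card_insert_of_notMem hz]
              push_cast
              ring
  obtain ⟨φ, -, -, hf, hs, hE⟩ := hind Λ
  refine ⟨φ, hf, hs, hE.trans ?_⟩
  have h8 : 8 * (Λ.card : ℝ≥0∞) ≤ g 0 * ε :=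
    (ENNReal.div_le_iff_le_mul (Or.inl hε) (Or.inr hg0)).1 hN.le
  rw [← mul_div_assoc, mul_comm (Λ.card : ℝ≥0∞)]
  exact ENNReal.div_le_of_le_mul (h8.trans_eq (mul_comm _ _))

end Energy

/-! ### Planar rotations -/

section PlanarRotation
open Real

variable {E : Type*} [NormedAddCommGroup E] [InnerProductSpace ℝ E]

/-- The linear map which, for orthonormal `e` and `f`, rotates the oriented plane spanned by
`(e, f)` by the angle `t` and fixes the orthogonal complement of this plane. -/
noncomputable def planarRotationMap (e f : E) (t : ℝ) : E →ₗ[ℝ] E where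
  toFun v := v + ((cos t - 1) * inner ℝ e v - sin t * inner ℝ f v) • e
    + (sin t * inner ℝ e v + (cos t - 1) * inner ℝ f v) • f
  map_add' v w := by
    simp only [inner_add_right]
    module
  map_smul' c v := by
    simp only [inner_smul_right, RingHom.id_apply]
    module

theorem planarRotationMap_apply (e f : E) (t : ℝ) (v : E) :
    planarRotationMap e f t v = v + ((cos t - 1) * inner ℝ e v - sin t * inner ℝ f v) • e
      + (sin t * inner ℝ e v + (cos t - 1) * inner ℝ f v) • f := rfl

variable {e f : E}

theorem planarRotationMap_add (he : ‖e‖ = 1) (hf : ‖f‖ = 1) (hef : inner ℝ e f = 0) (s t : ℝ)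
    (v : E) :
    planarRotationMap e f (s + t) v = planarRotationMap e f s (planarRotationMap e f t v) := by
  have hfe : inner ℝ f e = 0 := by rw [real_inner_comm, hef]
  simp only [planarRotationMap_apply, inner_add_right, inner_smul_right,
    real_inner_self_eq_norm_sq, he, hf, hef, hfe, cos_add, sin_add]
  module

theorem norm_planarRotationMap (he : ‖e‖ = 1) (hf : ‖f‖ = 1) (hef : inner ℝ e f = 0) (t : ℝ)
    (v : E) : ‖planarRotationMap e f t v‖ = ‖v‖ := by
  have hfe : inner ℝ f e = 0 := by rw [real_inner_comm, hef]
  rw [← sq_eq_sq₀ (norm_nonneg _) (norm_nonneg _), ← real_inner_self_eq_norm_sq,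
    ← real_inner_self_eq_norm_sq]
  simp only [planarRotationMap_apply, inner_add_right, inner_add_left, inner_smul_right,
    inner_smul_left, real_inner_self_eq_norm_sq, he, hf, hef, hfe, real_inner_comm e v,
    real_inner_comm f v, conj_trivial]
  linear_combination (inner ℝ e v ^ 2 + inner ℝ f v ^ 2) * sin_sq_add_cos_sq t

/-- The rotation by the angle `t` in the oriented plane spanned by the orthonormal pair
`(e, f)`. -/
noncomputable def planarRotation (he : ‖e‖ = 1) (hf : ‖f‖ = 1) (hef : inner ℝ e f = 0) (t : ℝ) :
    E ≃ₗᵢ[ℝ] E where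
  toLinearEquiv := LinearEquiv.ofLinearMap (planarRotationMap e f t) (planarRotationMap e f (-t))
    (by
      ext v
      rw [LinearMap.comp_apply, ← planarRotationMap_add he hf hef]
      simp [planarRotationMap_apply])
    (by
      ext v
      rw [LinearMap.comp_apply, ← planarRotationMap_add he hf hef]
      simp [planarRotationMap_apply])
  norm_map' v := norm_planarRotationMap he hf hef t v

theorem planarRotation_apply (he : ‖e‖ = 1) (hf : ‖f‖ = 1) (hef : inner ℝ e f = 0) (t : ℝ)
    (v : E) :
    planarRotation he hf hef t v = v + ((cos t - 1) * inner ℝ e v - sin t * inner ℝ f v) • e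
      + (sin t * inner ℝ e v + (cos t - 1) * inner ℝ f v) • f := rfl

theorem planarRotation_add (he : ‖e‖ = 1) (hf : ‖f‖ = 1) (hef : inner ℝ e f = 0) (s t : ℝ) :
    planarRotation he hf hef (s + t) = planarRotation he hf hef s * planarRotation he hf hef t :=
  LinearIsometryEquiv.ext fun v => planarRotationMap_add he hf hef s t v

/-- Averaging a rotation with its inverse cancels the term of first order in the angle. -/
theorem inner_planarRotation_add_neg (he : ‖e‖ = 1) (hf : ‖f‖ = 1) (hef : inner ℝ e f = 0)
    (t : ℝ) {v w : E} (hv : ‖v‖ = 1) (hw : ‖w‖ = 1) :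
    2 * inner ℝ v w - 2 * t ^ 2 ≤ inner ℝ v (planarRotation he hf hef t w)
      + inner ℝ v (planarRotation he hf hef (-t) w) := by
  have h1 : |inner ℝ e v * inner ℝ e w + inner ℝ f v * inner ℝ f w| ≤ 2 := by
    have bound {a b : E} (ha : ‖a‖ = 1) (hb : ‖b‖ = 1) : |inner ℝ a b| ≤ 1 := by
      simpa [ha, hb] using abs_real_inner_le_norm a b
    calc _ ≤ |inner ℝ e v| * |inner ℝ e w| + |inner ℝ f v| * |inner ℝ f w| := by
          rw [← abs_mul, ← abs_mul]
          exact abs_add_le _ _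
      _ ≤ 1 * 1 + 1 * 1 := by
          gcongr <;> exact bound ‹_› ‹_›
      _ = 2 := by norm_num
  have h2 := one_sub_sq_div_two_le_cos (x := t)
  have h3 := cos_le_one t
  simp only [planarRotation_apply, inner_add_right, inner_smul_right, cos_neg, sin_neg,
    real_inner_comm e v, real_inner_comm f v]
  nlinarith [(abs_le.1 h1).1, (abs_le.1 h1).2]

theorem reflection_orthogonal_span_apply {u : E} (hu : ‖u‖ = 1) (v : E) :
    (ℝ ∙ u)ᗮ.reflection v = v - (2 * inner ℝ u v) • u := by
  rw [Submodule.reflection_orthogonal_apply, Submodule.reflection_singleton_apply]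
  simp only [hu]
  norm_num
  module

/-- The composition of the reflections in two unit vectors is the identity, or the rotation by
twice the angle between them in the plane which they span. -/
theorem reflection_mul_reflection_eq {u e : E} (hu : ‖u‖ = 1) (he : ‖e‖ = 1) :
    (ℝ ∙ u)ᗮ.reflection * (ℝ ∙ e)ᗮ.reflection = 1 ∨
      ∃ (f : E) (hf : ‖f‖ = 1) (hef : inner ℝ e f = 0) (t : ℝ),
        (ℝ ∙ u)ᗮ.reflection * (ℝ ∙ e)ᗮ.reflection = planarRotation he hf hef t := by
  set a : ℝ := inner ℝ e u with ha
  set w : E := u - a • e with hw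
  have hew : inner ℝ e w = 0 := by
    simp [hw, inner_sub_right, inner_smul_right, he, ha]
  have huw : u = a • e + w := by simp [hw]
  by_cases hw0 : w = 0
  · left
    have hua : u = a • e := by rw [huw, hw0, add_zero]
    have haa : a ≠ 0 := by
      rintro h
      rw [hua, h] at hu
      simp at hu
    have hspan : (ℝ ∙ u) = ℝ ∙ e := by
      rw [hua]
      exact Submodule.span_singleton_smul_eq (IsUnit.mk0 a haa) e
    simp only [hspan]
    exact Submodule.reflection_mul_reflection _
  · right
    set b := ‖w‖ with hb
    have hb0 : b ≠ 0 := norm_ne_zero_iff.2 hw0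
    obtain ⟨f, hfdef⟩ : ∃ f, f = b⁻¹ • w := ⟨_, rfl⟩
    have hf : ‖f‖ = 1 := by
      rw [hfdef, norm_smul, norm_inv, norm_norm, inv_mul_cancel₀ hb0]
    have hef : inner ℝ e f = 0 := by rw [hfdef, inner_smul_right, hew, mul_zero]
    have huf : u = a • e + b • f := by
      rw [hfdef, smul_inv_smul₀ hb0]
      exact huw
    have hab : a ^ 2 + b ^ 2 = 1 := by
      have h := real_inner_self_eq_norm_sq u
      have hfe : inner ℝ f e = 0 := by rw [real_inner_comm, hef]
      rw [hu] at h
      nth_rewrite 1 [huf] at h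
      nth_rewrite 1 [huf] at h
      simp only [inner_add_left, inner_add_right, inner_smul_left, inner_smul_right, hef, hfe,
        real_inner_self_eq_norm_sq, he, hf, conj_trivial] at h
      linarith
    obtain ⟨s, hcs, hsn⟩ : ∃ s, cos s = a ∧ sin s = b := by
      have hz : ‖(⟨a, b⟩ : ℂ)‖ = 1 := by
        rw [Complex.norm_eq_sqrt_sq_add_sq, hab, sqrt_one]
      refine ⟨Complex.arg ⟨a, b⟩, ?_, ?_⟩
      · rw [Complex.cos_arg (by rintro h; rw [h] at hz; simp at hz), hz, div_one]
      · rw [Complex.sin_arg, hz, div_one]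
    refine ⟨f, hf, hef, 2 * s, LinearIsometryEquiv.ext fun v => ?_⟩
    have hc2 : cos (2 * s) - 1 = -2 * b ^ 2 := by
      rw [cos_two_mul, hcs]
      linarith
    rw [planarRotation_apply, hc2, sin_two_mul, hcs, hsn, LinearIsometryEquiv.coe_mul,
      Function.comp_apply, reflection_orthogonal_span_apply hu, reflection_orthogonal_span_apply he,
      huf]
    simp only [inner_sub_right, inner_add_left, inner_smul_left, inner_smul_right, conj_trivial,
      real_inner_self_eq_norm_sq, he, real_inner_comm e f, hef]
    linear_combination (norm := module) ((2 * inner ℝ e v) * hab) • e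

/-- A property of isometries which holds for the identity and for planar rotations and is stable
under composition holds for every isometry of determinant `1`. -/
theorem rotation_induction [FiniteDimensional ℝ E] {P : (E ≃ₗᵢ[ℝ] E) → Prop} (one : P 1)
    (mul : ∀ A B, P A → P B → P (A * B))
    (planar : ∀ (e f : E) (he : ‖e‖ = 1) (hf : ‖f‖ = 1) (hef : inner ℝ e f = 0) (t : ℝ),
      P (planarRotation he hf hef t))
    (A : E ≃ₗᵢ[ℝ] E) (hA : LinearMap.det (A.toLinearEquiv : E →ₗ[ℝ] E) = 1) : P A := by
  classical
  set r : E → (E ≃ₗᵢ[ℝ] E) := fun v => (ℝ ∙ v)ᗮ.reflection with hr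
  have hunit (v : E) (hv : v ≠ 0) : ∃ u : E, ‖u‖ = 1 ∧ r u = r v := by
    have hv' : ‖v‖ ≠ 0 := norm_ne_zero_iff.2 hv
    refine ⟨‖v‖⁻¹ • v, by rw [norm_smul, norm_inv, norm_norm, inv_mul_cancel₀ hv'], ?_⟩
    have := Submodule.span_singleton_smul_eq (IsUnit.mk0 ‖v‖⁻¹ (inv_ne_zero hv')) v
    simp only [hr, this]
  have hpair (v w : E) (hv : v ≠ 0) (hw : w ≠ 0) : P (r v * r w) := by
    obtain ⟨u, hu, huv⟩ := hunit v hv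
    obtain ⟨e, he, hew⟩ := hunit w hw
    rw [← huv, ← hew]
    rcases reflection_mul_reflection_eq hu he with h | ⟨f, hf, hef, t, h⟩
    · exact h ▸ one
    · exact h ▸ planar e f he hf hef t
  have hrzero : r 0 = 1 := by
    refine LinearIsometryEquiv.ext fun x => ?_
    exact Submodule.reflection_mem_subspace_eq_self (by simp)
  have hdet (v : E) (hv : v ≠ 0) :
      LinearMap.det ((r v).toLinearEquiv : E →ₗ[ℝ] E) = -1 := by
    have h := (ℝ ∙ v)ᗮ.det_reflection
    rw [Submodule.orthogonal_orthogonal, finrank_span_singleton hv, pow_one] at h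
    exact h
  have hdetmul (B C : E ≃ₗᵢ[ℝ] E) : LinearMap.det ((B * C).toLinearEquiv : E →ₗ[ℝ] E)
      = LinearMap.det (B.toLinearEquiv : E →ₗ[ℝ] E)
        * LinearMap.det (C.toLinearEquiv : E →ₗ[ℝ] E) := by
    rw [← LinearMap.det_comp]
    rfl
  -- Group the reflections in pairs, keeping the last one aside if their number is odd.
  have hlist (l : List E) :
      (LinearMap.det ((l.map r).prod.toLinearEquiv : E →ₗ[ℝ] E) = 1 → P (l.map r).prod) ∧
      (LinearMap.det ((l.map r).prod.toLinearEquiv : E →ₗ[ℝ] E) ≠ 1 →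
        LinearMap.det ((l.map r).prod.toLinearEquiv : E →ₗ[ℝ] E) = -1 ∧
        ∀ v, v ≠ 0 → P (r v * (l.map r).prod)) := by
    induction l with
    | nil =>
      refine ⟨fun _ => by simpa using one, fun h => absurd ?_ h⟩
      simp only [List.map_nil, List.prod_nil]
      exact LinearMap.det_id
    | cons w l ih =>
      rw [List.map_cons, List.prod_cons]
      by_cases hw : w = 0
      · rw [hw, hrzero, one_mul]
        exact ih
      rw [hdetmul, hdet w hw]
      by_cases h1 : LinearMap.det ((l.map r).prod.toLinearEquiv : E →ₗ[ℝ] E) = 1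
      · rw [h1]
        refine ⟨fun h => by norm_num at h, fun _ => ⟨by norm_num, fun v hv => ?_⟩⟩
        rw [← mul_assoc]
        exact mul _ _ (hpair v w hv hw) (ih.1 h1)
      · obtain ⟨h2, h3⟩ := ih.2 h1
        rw [h2]
        exact ⟨fun _ => h3 w hw, fun h => by norm_num at h⟩
  obtain ⟨l, -, hl⟩ := A.reflections_generate_dim
  have hl' : A = (l.map r).prod := hl
  rw [hl'] at hA ⊢
  exact (hlist l).1 hA

end PlanarRotation

/-! ### Rotations of spins and the surface measure -/

section Spin
open scoped Pointwise

variable {d n : ℕ}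

/-- The action of a linear isometry on a single spin. -/
noncomputable def rotateSpin
    (A : EuclideanSpace ℝ (Fin n) ≃ₗᵢ[ℝ] EuclideanSpace ℝ (Fin n)) (s : Spin n) : Spin n :=
  ⟨A s, by simp⟩

theorem rotateSpin_mul (A B : EuclideanSpace ℝ (Fin n) ≃ₗᵢ[ℝ] EuclideanSpace ℝ (Fin n))
    (s : Spin n) : rotateSpin (A * B) s = rotateSpin A (rotateSpin B s) := rfl

theorem rotateSpin_one (s : Spin n) : rotateSpin 1 s = s := rfl

theorem continuous_rotateSpin
    (A : EuclideanSpace ℝ (Fin n) ≃ₗᵢ[ℝ] EuclideanSpace ℝ (Fin n)) :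
    Continuous (rotateSpin A) :=
  (A.continuous.comp continuous_subtype_val).subtype_mk _

instance : IsFiniteMeasure (surfaceMeasure n) := by
  unfold surfaceMeasure
  infer_instance

theorem measurePreserving_rotateSpin
    (A : EuclideanSpace ℝ (Fin n) ≃ₗᵢ[ℝ] EuclideanSpace ℝ (Fin n)) :
    MeasurePreserving (rotateSpin A) (surfaceMeasure n) (surfaceMeasure n) := by
  have hm : Measurable (rotateSpin A) := (continuous_rotateSpin A).measurable
  refine ⟨hm, Measure.ext fun s hs => ?_⟩
  rw [Measure.map_apply hm hs, surfaceMeasure, Measure.toSphere_apply' _ hs,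
    Measure.toSphere_apply' _ (hm hs)]
  congr 1
  rw [← A.measurePreserving.measure_preimage_emb A.toHomeomorph.measurableEmbedding
    (Set.Ioo (0 : ℝ) 1 • (Subtype.val '' s))]
  congr 1
  ext v
  simp only [Set.mem_smul, Set.mem_preimage, Set.mem_image]
  constructor
  · rintro ⟨r, hr, _, ⟨u, hu, rfl⟩, rfl⟩
    exact ⟨r, hr, _, ⟨_, hu, rfl⟩, (map_smul A r _).symm⟩
  · rintro ⟨r, hr, _, ⟨u, hu, rfl⟩, h⟩
    refine ⟨r, hr, _, ⟨rotateSpin A⁻¹ u, ?_, rfl⟩, ?_⟩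
    · rwa [← rotateSpin_mul, mul_inv_cancel, rotateSpin_one]
    · apply A.injective
      rw [← h, map_smul]
      congr 1
      exact A.apply_symm_apply u

theorem measurable_rotateSpins
    (A : EuclideanSpace ℝ (Fin n) ≃ₗᵢ[ℝ] EuclideanSpace ℝ (Fin n)) :
    Measurable (rotateSpins A : SpinConfig d n → SpinConfig d n) :=
  measurable_pi_lambda _ fun x =>
    (continuous_rotateSpin A).measurable.comp (measurable_pi_apply x)

end Spin

/-! ### The Hamiltonian under local rotations -/

section Hamiltonian
open scoped ENNReal

variable {d n : ℕ} {J : Site d → Site d → ℝ}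
  {R : ℝ → EuclideanSpace ℝ (Fin n) ≃ₗᵢ[ℝ] EuclideanSpace ℝ (Fin n)}

/-- The couplings of the pairs of sites which meet `Λ` are summable; they dominate the terms of the
Hamiltonian. -/
theorem summable_touching (hJ_trans : ∀ x y, J x y = J 0 (y - x)) (hJ_nonneg : ∀ x y, 0 ≤ J x y)
    (hJ : Summable (J 0)) (Λ : Finset (Site d)) :
    Summable fun q : Site d × Site d => if q.1 ∈ Λ ∨ q.2 ∈ Λ then J q.1 q.2 else 0 := by
  have hrow (a : Site d) :
      Summable fun q : Site d × Site d => if q.1 = a then J q.1 q.2 else 0 := by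
    have hinj : Function.Injective fun y : Site d => (a, y) := Prod.mk_right_injective a
    refine (hinj.summable_iff ?_).1 ?_
    · rintro ⟨x, y⟩ hq
      refine if_neg ?_
      rintro rfl
      exact hq ⟨y, rfl⟩
    · refine ((Equiv.subRight a).summable_iff.2 hJ).congr fun y => ?_
      simp [hJ_trans a]
  have hcol (a : Site d) :
      Summable fun q : Site d × Site d => if q.2 = a then J q.1 q.2 else 0 := by
    have hinj : Function.Injective fun x : Site d => (x, a) := Prod.mk_left_injective a
    refine (hinj.summable_iff ?_).1 ?_
    · rintro ⟨x, y⟩ hq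
      refine if_neg ?_
      rintro rfl
      exact hq ⟨x, rfl⟩
    · refine ((Equiv.subLeft a).summable_iff.2 hJ).congr fun x => ?_
      simp [hJ_trans x]
  refine Summable.of_nonneg_of_le (fun q => ?_) (fun q => ?_)
    ((summable_sum fun a (_ : a ∈ Λ) => hrow a).add (summable_sum fun a (_ : a ∈ Λ) => hcol a))
  · split_ifs
    exacts [hJ_nonneg _ _, le_rfl]
  · simp only [Finset.sum_ite_eq]
    have := hJ_nonneg q.1 q.2
    by_cases h1 : q.1 ∈ Λ <;> by_cases h2 : q.2 ∈ Λ <;> simp [h1, h2, this]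

/-- The contribution of an ordered pair of sites to the Hamiltonian in `Λ`, up to the factor
`-1/2`. -/
noncomputable def interaction (J : Site d → Site d → ℝ) (Λ : Finset (Site d))
    (S : SpinConfig d n) (q : Site d × Site d) : ℝ :=
  if q.1 ∈ Λ ∨ q.2 ∈ Λ then
    J q.1 q.2 * inner ℝ (S q.1 : EuclideanSpace ℝ (Fin n)) (S q.2 : EuclideanSpace ℝ (Fin n))
  else 0

theorem hamiltonian_eq (Λ : Finset (Site d)) (S : SpinConfig d n) :
    hamiltonian J Λ S = -(1 / 2) * ∑' q, interaction J Λ S q := rfl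

theorem norm_interaction_le (hJ_nonneg : ∀ x y, 0 ≤ J x y) (Λ : Finset (Site d))
    (S : SpinConfig d n) (q : Site d × Site d) :
    ‖interaction J Λ S q‖ ≤ if q.1 ∈ Λ ∨ q.2 ∈ Λ then J q.1 q.2 else 0 := by
  unfold interaction
  split_ifs
  · rw [norm_mul, Real.norm_of_nonneg (hJ_nonneg _ _)]
    refine mul_le_of_le_one_right (hJ_nonneg _ _) ?_
    simpa using norm_inner_le_norm (𝕜 := ℝ) (S q.1 : EuclideanSpace ℝ (Fin n))
      (S q.2 : EuclideanSpace ℝ (Fin n))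
  · simp

theorem continuous_hamiltonian (hJ_trans : ∀ x y, J x y = J 0 (y - x))
    (hJ_nonneg : ∀ x y, 0 ≤ J x y) (hJ : Summable (J 0)) (Λ : Finset (Site d)) :
    Continuous (hamiltonian J Λ : SpinConfig d n → ℝ) := by
  refine continuous_const.mul (continuous_tsum (f := fun q S => interaction J Λ S q) (fun q => ?_)
    (summable_touching hJ_trans hJ_nonneg hJ Λ) fun q S => norm_interaction_le hJ_nonneg Λ S q)
  unfold interaction
  split_ifs
  · fun_prop
  · exact continuous_const

theorem continuous_concat (Λ : Finset (Site d)) (S : SpinConfig d n) :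
    Continuous fun ζ : Λ → Spin n => concat Λ ζ S := by
  refine continuous_pi fun x => ?_
  unfold concat
  split_ifs
  · fun_prop
  · exact continuous_const

theorem measurable_boltzmannWeight (hJ_trans : ∀ x y, J x y = J 0 (y - x))
    (hJ_nonneg : ∀ x y, 0 ≤ J x y) (hJ : Summable (J 0)) (β : ℝ) (Λ : Finset (Site d))
    (S : SpinConfig d n) : Measurable (boltzmannWeight J β Λ S) := by
  have h := (continuous_hamiltonian (n := n) hJ_trans hJ_nonneg hJ Λ).comp (continuous_concat Λ S)
  exact ENNReal.measurable_ofReal.comp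
    (Real.continuous_exp.comp (continuous_const.mul h)).measurable

/-- Rotating the spin at each site `x` by the angle `φ_x`, and averaging over `φ` and `-φ`, raises
the energy by at most half the Dirichlet energy of `φ`: the terms of first order cancel. -/
theorem hamiltonian_rotate_add_le (hJ_trans : ∀ x y, J x y = J 0 (y - x))
    (hJ_nonneg : ∀ x y, 0 ≤ J x y) (hJ : Summable (J 0))
    (hadd : ∀ s t, R (s + t) = R s * R t)
    (hquad : ∀ (t : ℝ) (v w : EuclideanSpace ℝ (Fin n)), ‖v‖ = 1 → ‖w‖ = 1 →
      2 * inner ℝ v w - 2 * t ^ 2 ≤ inner ℝ v (R t w) + inner ℝ v (R (-t) w))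
    (Λ : Finset (Site d)) {φ : Site d → ℝ} (hφ : dirichletEnergy J φ ≠ ∞) (S : SpinConfig d n) :
    hamiltonian J Λ (fun x => rotateSpin (R (φ x)) (S x))
      + hamiltonian J Λ (fun x => rotateSpin (R (-φ x)) (S x))
      ≤ 2 * hamiltonian J Λ S + (dirichletEnergy J φ).toReal := by
  have hsum (S : SpinConfig d n) : Summable (interaction J Λ S) :=
    Summable.of_norm_bounded (summable_touching hJ_trans hJ_nonneg hJ Λ)
      fun q => norm_interaction_le hJ_nonneg Λ S q
  have hterm (q : Site d × Site d) :
      (ENNReal.ofReal (J q.1 q.2) * ENNReal.ofReal ((φ q.1 - φ q.2) ^ 2)).toReal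
        = J q.1 q.2 * (φ q.1 - φ q.2) ^ 2 := by
    rw [ENNReal.toReal_mul, ENNReal.toReal_ofReal (hJ_nonneg _ _),
      ENNReal.toReal_ofReal (sq_nonneg _)]
  have hE : HasSum (fun q : Site d × Site d => J q.1 q.2 * (φ q.1 - φ q.2) ^ 2)
      (dirichletEnergy J φ).toReal := by
    rw [dirichletEnergy, ENNReal.tsum_toReal_eq fun q => by finiteness]
    simp only [← hterm]
    exact ENNReal.hasSum_toReal hφ
  -- The rotation angles enter each interaction only through their difference.
  have hinner (ψ : Site d → ℝ) (x y : Site d) :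
      inner ℝ (rotateSpin (R (ψ x)) (S x) : EuclideanSpace ℝ (Fin n))
        (rotateSpin (R (ψ y)) (S y) : EuclideanSpace ℝ (Fin n))
      = inner ℝ (S x : EuclideanSpace ℝ (Fin n)) (R (ψ y - ψ x) (S y)) := by
    have h : R (ψ y) = R (ψ x) * R (ψ y - ψ x) := by rw [← hadd, add_sub_cancel]
    simp only [rotateSpin, h, LinearIsometryEquiv.coe_mul, Function.comp_apply,
      LinearIsometryEquiv.inner_map_map]
  set S₁ : SpinConfig d n := fun x => rotateSpin (R (φ x)) (S x) with hS₁
  set S₂ : SpinConfig d n := fun x => rotateSpin (R (-φ x)) (S x) with hS₂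
  have hle (q : Site d × Site d) : 2 * interaction J Λ S q ≤
      interaction J Λ S₁ q + interaction J Λ S₂ q + 2 * (J q.1 q.2 * (φ q.1 - φ q.2) ^ 2) := by
    have h0 : 0 ≤ J q.1 q.2 * (φ q.1 - φ q.2) ^ 2 := mul_nonneg (hJ_nonneg _ _) (sq_nonneg _)
    unfold interaction
    split_ifs
    · rw [hinner φ, hinner (fun x => -φ x), show -φ q.2 - -φ q.1 = -(φ q.2 - φ q.1) by ring]
      have h1 := hquad (φ q.2 - φ q.1) (S q.1) (S q.2) (by simp) (by simp)
      have h2 := mul_le_mul_of_nonneg_left h1 (hJ_nonneg q.1 q.2)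
      rw [show φ q.1 - φ q.2 = -(φ q.2 - φ q.1) by ring, neg_sq]
      linarith
    · linarith
  have key := hasSum_le hle ((hsum S).hasSum.mul_left 2)
    (((hsum S₁).hasSum.add (hsum S₂).hasSum).add (hE.mul_left 2))
  simp only [hamiltonian_eq]
  linarith

end Hamiltonian

/-! ### Local rotations of Gibbs measures -/

section Gibbs
open scoped ENNReal

variable {d n : ℕ} {J : Site d → Site d → ℝ}
  {R : ℝ → EuclideanSpace ℝ (Fin n) ≃ₗᵢ[ℝ] EuclideanSpace ℝ (Fin n)}

theorem eq_one_of_map_add (hadd : ∀ s t, R (s + t) = R s * R t) : R 0 = 1 := by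
  have h := hadd 0 0
  rwa [add_zero, left_eq_mul] at h

theorem rotateSpin_neg_rotateSpin (hadd : ∀ s t, R (s + t) = R s * R t) (t : ℝ) (s : Spin n) :
    rotateSpin (R (-t)) (rotateSpin (R t) s) = s := by
  rw [← rotateSpin_mul, ← hadd, neg_add_cancel, eq_one_of_map_add hadd, rotateSpin_one]

/-- Rotation of the spins in the finite volume `Λ` by site-dependent angles. -/
noncomputable def rotateIn (R : ℝ → EuclideanSpace ℝ (Fin n) ≃ₗᵢ[ℝ] EuclideanSpace ℝ (Fin n))
    (Λ : Finset (Site d)) (φ : Site d → ℝ) (ζ : Λ → Spin n) : Λ → Spin n :=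
  fun x => rotateSpin (R (φ x)) (ζ x)

theorem measurePreserving_rotateIn (Λ : Finset (Site d)) (φ : Site d → ℝ) :
    MeasurePreserving (rotateIn R Λ φ) (Measure.pi fun _ : Λ => surfaceMeasure n)
      (Measure.pi fun _ : Λ => surfaceMeasure n) :=
  measurePreserving_pi _ _ fun x : Λ => measurePreserving_rotateSpin (R (φ x))

theorem concat_rotateIn (hadd : ∀ s t, R (s + t) = R s * R t) {Λ : Finset (Site d)}
    {φ : Site d → ℝ} (hφ : ∀ x ∉ Λ, φ x = 0) (S : SpinConfig d n) (ζ : Λ → Spin n) :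
    concat Λ (rotateIn R Λ φ ζ) S = fun x => rotateSpin (R (φ x)) (concat Λ ζ S x) := by
  ext1 x
  by_cases hx : x ∈ Λ
  · simp [concat, hx, rotateIn]
  · simp [concat, hx, hφ x hx, eq_one_of_map_add hadd, rotateSpin_one]

/-- By the inequality between the arithmetic and geometric means, the quadratic bound on the
energy becomes a lower bound on the mean of the Boltzmann weights of the configurations
rotated by `φ` and by `-φ`. -/
theorem boltzmannWeight_rotateIn_add_ge (hJ_trans : ∀ x y, J x y = J 0 (y - x))
    (hJ_nonneg : ∀ x y, 0 ≤ J x y) (hJ : Summable (J 0))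
    (hadd : ∀ s t, R (s + t) = R s * R t)
    (hquad : ∀ (t : ℝ) (v w : EuclideanSpace ℝ (Fin n)), ‖v‖ = 1 → ‖w‖ = 1 →
      2 * inner ℝ v w - 2 * t ^ 2 ≤ inner ℝ v (R t w) + inner ℝ v (R (-t) w))
    {β : ℝ} (hβ : 0 ≤ β) {Λ : Finset (Site d)} {φ : Site d → ℝ} (hφΛ : ∀ x ∉ Λ, φ x = 0)
    {ε : ℝ} (hε : 0 ≤ ε) (hφ : dirichletEnergy J φ ≤ ENNReal.ofReal ε)
    (S : SpinConfig d n) (ζ : Λ → Spin n) :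
    ENNReal.ofReal (2 * Real.exp (-(β * ε / 2))) * boltzmannWeight J β Λ S ζ
      ≤ boltzmannWeight J β Λ S (rotateIn R Λ φ ζ)
        + boltzmannWeight J β Λ S (rotateIn R Λ (-φ) ζ) := by
  have hE := hamiltonian_rotate_add_le hJ_trans hJ_nonneg hJ hadd hquad Λ
    (ne_top_of_le_ne_top ENNReal.ofReal_ne_top hφ) (concat Λ ζ S)
  have hεE : (dirichletEnergy J φ).toReal ≤ ε := ENNReal.toReal_le_of_le_ofReal hε hφ
  unfold boltzmannWeight
  rw [concat_rotateIn hadd hφΛ, concat_rotateIn hadd (φ := -φ) (by simpa using hφΛ),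
    ← ENNReal.ofReal_mul (by positivity), ← ENNReal.ofReal_add (by positivity) (by positivity)]
  refine ENNReal.ofReal_le_ofReal ?_
  simp only [Pi.neg_apply]
  set h0 := hamiltonian J Λ (concat Λ ζ S)
  set h1 := hamiltonian J Λ fun x => rotateSpin (R (φ x)) (concat Λ ζ S x)
  set h2 := hamiltonian J Λ fun x => rotateSpin (R (-φ x)) (concat Λ ζ S x)
  calc 2 * Real.exp (-(β * ε / 2)) * Real.exp (-β * h0)
      = 2 * Real.exp (-(β * ε / 2) + -β * h0) := by rw [Real.exp_add, mul_assoc]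
    _ ≤ 2 * Real.exp (-β * h1 / 2 + -β * h2 / 2) := by
        refine mul_le_mul_of_nonneg_left (Real.exp_le_exp.2 ?_) zero_le_two
        have h : β * (h1 + h2) ≤ β * (2 * h0 + ε) := mul_le_mul_of_nonneg_left (by linarith) hβ
        linarith
    _ ≤ Real.exp (-β * h1) + Real.exp (-β * h2) := by
        have e1 : Real.exp (-β * h1) = Real.exp (-β * h1 / 2) ^ 2 := by
          rw [← Real.exp_nat_mul]
          congr 1
          push_cast
          ring
        have e2 : Real.exp (-β * h2) = Real.exp (-β * h2 / 2) ^ 2 := by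
          rw [← Real.exp_nat_mul]
          congr 1
          push_cast
          ring
        rw [Real.exp_add, e1, e2, ← mul_assoc]
        exact two_mul_le_add_sq _ _

theorem finiteGibbs_preimage_rotateIn (hadd : ∀ s t, R (s + t) = R s * R t) (β : ℝ)
    (Λ : Finset (Site d)) (φ : Site d → ℝ) (S : SpinConfig d n)
    (hm : Measurable (boltzmannWeight J β Λ S)) {B : Set (Λ → Spin n)} (hB : MeasurableSet B) :
    finiteGibbs J β Λ S (rotateIn R Λ φ ⁻¹' B) = (partitionFunction J β Λ S)⁻¹ *
      ∫⁻ ζ in B, boltzmannWeight J β Λ S (rotateIn R Λ (-φ) ζ)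
        ∂(Measure.pi fun _ : Λ => surfaceMeasure n) := by
  have hφ := measurePreserving_rotateIn (R := R) Λ φ
  have h := hφ.setLIntegral_comp_preimage hB
    (hm.comp (measurePreserving_rotateIn (R := R) Λ (-φ)).measurable)
  simp only [Function.comp_apply] at h
  rw [finiteGibbs, Measure.smul_apply, smul_eq_mul, withDensity_apply _ (hφ.measurable hB), ← h]
  congr 2 with ζ
  congr 1
  ext1 x
  exact (rotateSpin_neg_rotateSpin hadd (φ x) (ζ x)).symm

/-- This holds also where the partition function is `0` or `∞`, since then
`Z⁻¹ * Z = 0` in `[0, ∞]`. -/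
theorem finiteGibbs_univ_le_one (β : ℝ) (Λ : Finset (Site d)) (S : SpinConfig d n) :
    finiteGibbs J β Λ S Set.univ ≤ 1 := by
  rw [finiteGibbs, Measure.smul_apply, smul_eq_mul, withDensity_apply _ .univ,
    Measure.restrict_univ]
  exact ENNReal.inv_mul_le_one _

instance (β : ℝ) (Λ : Finset (Site d)) (S : SpinConfig d n) :
    IsFiniteMeasure (finiteGibbs J β Λ S) :=
  ⟨(finiteGibbs_univ_le_one β Λ S).trans_lt ENNReal.one_lt_top⟩

theorem finiteGibbs_rotateIn_add_ge (hJ_trans : ∀ x y, J x y = J 0 (y - x))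
    (hJ_nonneg : ∀ x y, 0 ≤ J x y) (hJ : Summable (J 0))
    (hadd : ∀ s t, R (s + t) = R s * R t)
    (hquad : ∀ (t : ℝ) (v w : EuclideanSpace ℝ (Fin n)), ‖v‖ = 1 → ‖w‖ = 1 →
      2 * inner ℝ v w - 2 * t ^ 2 ≤ inner ℝ v (R t w) + inner ℝ v (R (-t) w))
    {β : ℝ} (hβ : 0 ≤ β) {Λ : Finset (Site d)} {φ : Site d → ℝ} (hφΛ : ∀ x ∉ Λ, φ x = 0)
    {ε : ℝ} (hε : 0 ≤ ε) (hφ : dirichletEnergy J φ ≤ ENNReal.ofReal ε)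
    (S : SpinConfig d n) {B : Set (Λ → Spin n)} (hB : MeasurableSet B) :
    2 * Real.exp (-(β * ε / 2)) * (finiteGibbs J β Λ S).real B
      ≤ (finiteGibbs J β Λ S).real (rotateIn R Λ φ ⁻¹' B)
        + (finiteGibbs J β Λ S).real (rotateIn R Λ (-φ) ⁻¹' B) := by
  have hm := measurable_boltzmannWeight (n := n) hJ_trans hJ_nonneg hJ β Λ S
  have hm' : Measurable fun ζ => boltzmannWeight J β Λ S (rotateIn R Λ (-φ) ζ) :=
    hm.comp (measurePreserving_rotateIn (R := R) Λ (-φ)).measurable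
  have h : ENNReal.ofReal (2 * Real.exp (-(β * ε / 2))) * finiteGibbs J β Λ S B
      ≤ finiteGibbs J β Λ S (rotateIn R Λ φ ⁻¹' B)
        + finiteGibbs J β Λ S (rotateIn R Λ (-φ) ⁻¹' B) := by
    rw [finiteGibbs_preimage_rotateIn hadd β Λ φ S hm hB,
      finiteGibbs_preimage_rotateIn hadd β Λ (-φ) S hm hB, neg_neg, ← mul_add,
      ← lintegral_add_left hm',
      finiteGibbs, Measure.smul_apply, smul_eq_mul, withDensity_apply _ hB, mul_left_comm,
      ← lintegral_const_mul _ hm]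
    refine mul_le_mul_right (lintegral_mono fun ζ => ?_) _
    rw [add_comm]
    exact boltzmannWeight_rotateIn_add_ge hJ_trans hJ_nonneg hJ hadd hquad hβ hφΛ hε hφ S ζ
  have h2 := ENNReal.toReal_mono (by finiteness) h
  rwa [ENNReal.toReal_mul, ENNReal.toReal_ofReal (by positivity),
    ENNReal.toReal_add (by finiteness) (by finiteness)] at h2

variable {β : ℝ} {μ : Measure (SpinConfig d n)}

/-- Integrability in the boundary condition is inherited from the conditional expectation, so
measurability of the finite-volume Gibbs measure in the boundary condition is not needed. -/
theorem IsGibbsMeasure.integrable_finiteGibbs (hμ : IsGibbsMeasure J β μ) (Λ : Finset (Site d))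
    {B : Set (Λ → Spin n)} (hB : MeasurableSet B) :
    Integrable (fun S => (finiteGibbs J β Λ S).real B) μ :=
  integrable_condExp.congr (hμ.dlr Λ B hB)

theorem IsGibbsMeasure.integral_finiteGibbs (hμ : IsGibbsMeasure J β μ) (Λ : Finset (Site d))
    {B : Set (Λ → Spin n)} (hB : MeasurableSet B) :
    ∫ S, (finiteGibbs J β Λ S).real B ∂μ = μ.real (Λ.restrict ⁻¹' B) := by
  have := hμ.isProbabilityMeasure
  rw [← integral_congr_ae (hμ.dlr Λ B hB), integral_condExp cylinderEvents_le_pi,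
    integral_indicator (Finset.measurable_restrict Λ hB)]
  simp

/-- A Gibbs measure gives a local event at most the mean of the probabilities of its images under
a rotation and the inverse rotation: rotate the spins by angles which decrease from `θ` to `0`
so slowly that the Dirichlet energy is as small as desired. -/
theorem IsGibbsMeasure.two_mul_le_add (hμ : IsGibbsMeasure J β μ)
    (hJ_trans : ∀ x y, J x y = J 0 (y - x))
    (hJ_nonneg : ∀ x y, 0 ≤ J x y) (hJ_sum : HasSum (J 0) 1) (hJ_rec : IsRecurrentWalk (J 0))
    (hadd : ∀ s t, R (s + t) = R s * R t)
    (hquad : ∀ (t : ℝ) (v w : EuclideanSpace ℝ (Fin n)), ‖v‖ = 1 → ‖w‖ = 1 →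
      2 * inner ℝ v w - 2 * t ^ 2 ≤ inner ℝ v (R t w) + inner ℝ v (R (-t) w))
    (hβ : 0 ≤ β) (Λ₀ : Finset (Site d)) {B : Set (Λ₀ → Spin n)} (hB : MeasurableSet B) (θ : ℝ) :
    2 * μ.real (Λ₀.restrict ⁻¹' B) ≤ μ.real (rotateSpins (R θ) ⁻¹' (Λ₀.restrict ⁻¹' B))
      + μ.real (rotateSpins (R (-θ)) ⁻¹' (Λ₀.restrict ⁻¹' B)) := by
  classical
  have hbound (ε : ℝ) (hε : 0 < ε) : 2 * Real.exp (-(β * ε / 2)) * μ.real (Λ₀.restrict ⁻¹' B)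
      ≤ μ.real (rotateSpins (R θ) ⁻¹' (Λ₀.restrict ⁻¹' B))
        + μ.real (rotateSpins (R (-θ)) ⁻¹' (Λ₀.restrict ⁻¹' B)) := by
    have hθ : 0 < θ ^ 2 + 1 := by positivity
    obtain ⟨χ, hfin, h1, hE⟩ := exists_cutoff hJ_trans hJ_nonneg hJ_sum hJ_rec Λ₀
      (ε := ENNReal.ofReal (ε / (θ ^ 2 + 1))) (by simpa using div_pos hε hθ)
    set φ : Site d → ℝ := fun x => θ * χ x with hφ
    set Λ : Finset (Site d) := Λ₀ ∪ hfin.toFinset with hΛ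
    have hφΛ : ∀ x ∉ Λ, φ x = 0 := by
      intro x hx
      have : χ x = 0 := by
        by_contra h
        exact hx (Finset.mem_union_right _ (hfin.mem_toFinset.2 h))
      simp [hφ, this]
    have hφE : dirichletEnergy J φ ≤ ENNReal.ofReal ε := by
      calc dirichletEnergy J φ = ENNReal.ofReal (θ ^ 2) * dirichletEnergy J χ := by
            rw [dirichletEnergy, dirichletEnergy, ← ENNReal.tsum_mul_left]
            congr 1 with q
            rw [mul_left_comm, ← ENNReal.ofReal_mul (sq_nonneg θ), ← mul_pow, mul_sub]
        _ ≤ ENNReal.ofReal (θ ^ 2 + 1) * ENNReal.ofReal (ε / (θ ^ 2 + 1)) := by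
            gcongr
            linarith
        _ = ENNReal.ofReal ε := by
            rw [← ENNReal.ofReal_mul hθ.le, mul_div_cancel₀ _ hθ.ne']
    -- The event `B`, viewed as an event in the larger volume `Λ`.
    set C : Set (Λ → Spin n) :=
      Finset.restrict₂ (π := fun _ : Site d => Spin n) (Finset.subset_union_left) ⁻¹' B with hC
    have hCm : MeasurableSet C := Finset.measurable_restrict₂ _ hB
    have hplus : Λ.restrict ⁻¹' (rotateIn R Λ φ ⁻¹' C)
        = rotateSpins (R θ) ⁻¹' (Λ₀.restrict ⁻¹' B) := by
      ext S
      simp only [hC, Set.mem_preimage]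
      apply iff_of_eq
      congr 1
      ext1 x
      change rotateSpin (R (θ * χ x)) (S x) = rotateSpin (R θ) (S x)
      rw [h1 x x.2, mul_one]
    have hminus : Λ.restrict ⁻¹' (rotateIn R Λ (-φ) ⁻¹' C)
        = rotateSpins (R (-θ)) ⁻¹' (Λ₀.restrict ⁻¹' B) := by
      ext S
      simp only [hC, Set.mem_preimage]
      apply iff_of_eq
      congr 1
      ext1 x
      change rotateSpin (R (-(θ * χ x))) (S x) = rotateSpin (R (-θ)) (S x)
      rw [h1 x x.2, mul_one]
    have hp := (measurePreserving_rotateIn (R := R) Λ φ).measurable hCm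
    have hm := (measurePreserving_rotateIn (R := R) Λ (-φ)).measurable hCm
    have hint := integral_mono ((hμ.integrable_finiteGibbs Λ hCm).const_mul _)
      ((hμ.integrable_finiteGibbs Λ hp).add (hμ.integrable_finiteGibbs Λ hm))
      fun S => finiteGibbs_rotateIn_add_ge hJ_trans hJ_nonneg hJ_sum.summable hadd hquad hβ hφΛ
        hε.le hφE S hCm
    simp only [Pi.add_apply] at hint
    rw [integral_const_mul, integral_add (hμ.integrable_finiteGibbs Λ hp)
      (hμ.integrable_finiteGibbs Λ hm), hμ.integral_finiteGibbs Λ hCm,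
      hμ.integral_finiteGibbs Λ hp, hμ.integral_finiteGibbs Λ hm, hplus, hminus] at hint
    exact hint
  have hcont : Tendsto (fun ε : ℝ => 2 * Real.exp (-(β * ε / 2)) * μ.real (Λ₀.restrict ⁻¹' B))
      (nhdsWithin 0 (Set.Ioi 0)) (nhds (2 * μ.real (Λ₀.restrict ⁻¹' B))) := by
    have h : Continuous fun ε : ℝ =>
        2 * Real.exp (-(β * ε / 2)) * μ.real (Λ₀.restrict ⁻¹' B) := by fun_prop
    simpa using (h.tendsto 0).mono_left nhdsWithin_le_nhds
  exact le_of_tendsto hcont (eventually_mem_nhdsWithin.mono fun ε hε => hbound ε hε)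

end Gibbs

/-! ### Invariance -/

section Invariance

theorem le_of_convex_of_bounded {a : ℕ → ℝ} {C : ℝ} (hC : ∀ k, a k ≤ C)
    (ha : ∀ k, 2 * a (k + 1) ≤ a (k + 2) + a k) : a 1 ≤ a 0 := by
  by_contra! h
  have hstep (k : ℕ) : a 1 - a 0 ≤ a (k + 1) - a k := by
    induction k with
    | zero => exact le_rfl
    | succ k ih => linarith [ha k]
  have hlin (k : ℕ) : a 0 + k * (a 1 - a 0) ≤ a k := by
    induction k with
    | zero => simp
    | succ k ih =>
      push_cast
      linarith [hstep k]
  obtain ⟨k, hk⟩ := exists_nat_gt ((C - a 0) / (a 1 - a 0))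
  rw [div_lt_iff₀ (sub_pos.2 h)] at hk
  linarith [hlin k, hC k]

/-- A bounded convex function on the integers is constant. -/
theorem eq_of_convex_of_bounded {a : ℤ → ℝ} {C : ℝ} (hC : ∀ k, a k ≤ C)
    (ha : ∀ k, 2 * a k ≤ a (k + 1) + a (k - 1)) : a 1 = a 0 := by
  apply le_antisymm
  · refine le_of_convex_of_bounded (a := fun k : ℕ => a k) (fun k => hC k) fun k => ?_
    have h := ha (k + 1)
    rw [add_sub_cancel_right, add_assoc, one_add_one_eq_two] at h
    exact_mod_cast h
  · have h := le_of_convex_of_bounded (a := fun k : ℕ => a (1 - k)) (fun k => hC _) fun k => by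
      have h := ha (1 - (k + 1))
      rw [show (1 : ℤ) - (k + 1) + 1 = 1 - k by ring,
        show (1 : ℤ) - (k + 1) - 1 = 1 - (k + 2) by ring] at h
      push_cast
      linarith
    simpa using h

variable {d n : ℕ} {J : Site d → Site d → ℝ} {β : ℝ} {μ : Measure (SpinConfig d n)}
  {R : ℝ → EuclideanSpace ℝ (Fin n) ≃ₗᵢ[ℝ] EuclideanSpace ℝ (Fin n)}

/-- For a local event, `k ↦ μ (rotation by -k θ of the event)` is a bounded convex function on the
integers, hence constant. -/
theorem IsGibbsMeasure.map_rotateSpins_eq (hμ : IsGibbsMeasure J β μ)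
    (hJ_trans : ∀ x y, J x y = J 0 (y - x))
    (hJ_nonneg : ∀ x y, 0 ≤ J x y) (hJ_sum : HasSum (J 0) 1) (hJ_rec : IsRecurrentWalk (J 0))
    (hadd : ∀ s t, R (s + t) = R s * R t)
    (hquad : ∀ (t : ℝ) (v w : EuclideanSpace ℝ (Fin n)), ‖v‖ = 1 → ‖w‖ = 1 →
      2 * inner ℝ v w - 2 * t ^ 2 ≤ inner ℝ v (R t w) + inner ℝ v (R (-t) w))
    (hβ : 0 ≤ β) (θ : ℝ) : μ.map (rotateSpins (R θ)) = μ := by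
  have := hμ.isProbabilityMeasure
  refine IsProjectiveLimit.unique (P := fun I : Finset (Site d) => μ.map I.restrict)
    (fun I => ?_) fun I => rfl
  rw [Measure.map_map (Finset.measurable_restrict I) (measurable_rotateSpins _)]
  refine Measure.ext fun B hB => ?_
  rw [Measure.map_apply ((Finset.measurable_restrict I).comp (measurable_rotateSpins _)) hB,
    Measure.map_apply (Finset.measurable_restrict I) hB, Set.preimage_comp]
  have hconv (k : ℤ) : 2 * μ.real (rotateSpins (R (k * θ)) ⁻¹' (I.restrict ⁻¹' B))
      ≤ μ.real (rotateSpins (R ((k + 1 : ℤ) * θ)) ⁻¹' (I.restrict ⁻¹' B))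
        + μ.real (rotateSpins (R ((k - 1 : ℤ) * θ)) ⁻¹' (I.restrict ⁻¹' B)) := by
    have h := hμ.two_mul_le_add hJ_trans hJ_nonneg hJ_sum hJ_rec hadd hquad hβ I
      ((measurePreserving_rotateIn (R := R) I fun _ => k * θ).measurable hB) θ
    have e1 : R ((k + 1 : ℤ) * θ) = R (k * θ) * R θ := by
      rw [← hadd]
      congr 1
      push_cast
      ring
    have e2 : R ((k - 1 : ℤ) * θ) = R (k * θ) * R (-θ) := by
      rw [← hadd]
      congr 1
      push_cast
      ring
    rw [e1, e2]
    exact h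
  have h := eq_of_convex_of_bounded
    (a := fun k : ℤ => μ.real (rotateSpins (R (k * θ)) ⁻¹' (I.restrict ⁻¹' B)))
    (C := 1) (fun k => measureReal_le_one) hconv
  simp only [Int.cast_one, one_mul, Int.cast_zero, zero_mul, eq_one_of_map_add hadd] at h
  exact (measureReal_eq_measureReal_iff).1 h

theorem mainTheorem3 (d n : ℕ) (hn : 2 ≤ n) (J : Site d → Site d → ℝ)
    (hJ_nonneg : ∀ x y, 0 ≤ J x y)
    (hJ_diag : ∀ x, J x x = 0)
    (hJ_trans : ∀ x y, J x y = J 0 (y - x))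
    (hJ_summable : Summable fun x => |J 0 x|)
    (hJ_sum : ∑' x, J 0 x = 1)
    (hJ_rec : IsRecurrentWalk (J 0))
    (β : ℝ) (hβ : 0 ≤ β)
    (μ : MeasureTheory.Measure (SpinConfig d n)) (hμ : IsGibbsMeasure J β μ)
    (A : EuclideanSpace ℝ (Fin n) ≃ₗᵢ[ℝ] EuclideanSpace ℝ (Fin n))
    (hA : LinearMap.det (A.toLinearEquiv : EuclideanSpace ℝ (Fin n) →ₗ[ℝ]
      EuclideanSpace ℝ (Fin n)) = 1) :
    μ.map (rotateSpins A) = μ := by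
  have hsum : HasSum (J 0) 1 := hJ_sum ▸ hJ_summable.of_abs.hasSum
  refine rotation_induction (P := fun A => μ.map (rotateSpins A) = μ) Measure.map_id
    (fun A B hA hB => ?_) (fun e f he hf hef t => ?_) A hA
  · have h : (rotateSpins (A * B) : SpinConfig d n → SpinConfig d n)
        = rotateSpins A ∘ rotateSpins B := rfl
    rw [h, ← Measure.map_map (measurable_rotateSpins A) (measurable_rotateSpins B), hB, hA]
  · exact hμ.map_rotateSpins_eq hJ_trans hJ_nonneg hsum hJ_rec (planarRotation_add he hf hef)
      (fun t v w => inner_planarRotation_add_neg he hf hef t) hβ t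

end Invariance
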